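/- For $n\in\mathbb N$ and $p\in[0,1]$ let $\vec G(n,p)$ be the random simple directed graph on the vertices $1,\dots,n$ in which each of the $n(n-1)$ possible directed edges (no loops; opposite edges $(i,j)$ and $(j,i)$ may both occur) is present independently with probability $p$; that is, a given digraph with $m$ edges appears with probability $p^m(1-p)^{n(n-1)-m}$. For a digraph $G$, the directed flag chain complex has, in degree $k\ge 0$, the free $\mathbb Z$-module on the tuples $(v_0,\dots,v_k)$ of distinct vertices with an edge from $v_i$ to $v_j$ whenever $i<j$, and $\mathbb Z$ in degree $-1$; its boundary is $\partial_k(v_0,\dots,v_k)=\sum_{i=0}^k(-1)^i(v_0,\dots,\widehat{v_i},\dots,v_k)$, where $\partial_0$ is the sum of coefficients. Let $\beta_k(G)$ be the rank of $\ker\partial_k/\operatorname{im}\partial_{k+1}$. For sequences, $f=o(g)$ and $g=\omega(f)$ both mean that for every $c>0$ one has $|f(n)|\le c\,|g(n)|$ for all sufficiently large $n$. (I) Let $\alpha\in\mathbb R$, let $p(n)=n^{\alpha}$ and $G\sim\vec G(n,p(n))$. (a) If $-1<\alpha<-1/2$, then $\displaystyle\lim_{n\to\infty}\frac{\mathbb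 E[\beta_1(G)]}{n(n-1)p(n)}=1$. (b) If $-1<\alpha<-1/2$, then $\mathbb P(\beta_1(G)>0)\to1$ as $n\to\infty$. (c) If $\alpha<-1$, then $\mathbb P(\beta_1(G)=0)\to1$ as $n\to\infty$. (d) If $-1/4<\alpha\le 0$, then $\mathbb P(\beta_1(G)=0)\to1$ as $n\to\infty$. (II) Let $p:\mathbb N\to[0,1]$ be any function and $G\sim\vec G(n,p(n))$. (a) Let $k\ge0$ be an integer. If $p(n)=\omega(n^{-1/k})$ (no condition when $k=0$) and $p(n)=o(n^{-1/(k+1)})$, then $$\lim_{n\to\infty}\frac{\mathbb E[\beta_k(G)]}{\binom{n}{k+1}(k+1)!\,p(n)^{\binom{k+1}{2}}}=1 .$$ (b) If $p(n)=\omega(n^{-1})$ and $p(n)=o(n^{-1/2})$, then $\mathbb P(\beta_1(G)>0)\to1$ as $n\to\infty$. (c) If $p(n)=o(n^{-1})$, then $\mathbb P(\beta_1(G)=0)\to1$ as $n\to\infty$. (d) If $p(n)=\omega\big((n/\log n)^{-1/4}\big)$, then $\mathbb P(\beta_1(G)=0)\to1$ as $n\to\infty$. -/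

import Mathlib

open Filter Asymptotics
open scoped Topology

noncomputable section

/-- A simple digraph on the vertex set `V`: a set of ordered pairs of distinct vertices
(no loops; both `(i, j)` and `(j, i)` may be present). -/
abbrev SimpleDigraph (V : Type) : Type :=
  {E : Finset (V × V) // ∀ e ∈ E, e.1 ≠ e.2}

namespace SimpleDigraph

/-- The set of directed edges. -/
def edges {V : Type} (G : SimpleDigraph V) : Finset (V × V) := G.1

/-! ### The directed flag complex and its homology -/

/-- A directed `m`-clique: an `m`-tuple of distinct vertices `(v₀, …, v_{m-1})` with an edge
from `vᵢ` to `vⱼ` whenever `i < j`. The directed `(k+1)`-cliques are the `k`-simplices of the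
directed flag complex. There is exactly one directed `0`-clique, the empty tuple. -/
def DirectedClique {V : Type} (G : SimpleDigraph V) (m : ℕ) : Type :=
  {v : Fin m → V // Function.Injective v ∧ ∀ i j : Fin m, i < j → (v i, v j) ∈ G.edges}

/-- Removal of the `i`-th vertex of a directed clique. -/
def DirectedClique.face {V : Type} {G : SimpleDigraph V} {m : ℕ}
    (c : G.DirectedClique (m + 1)) (i : Fin (m + 1)) : G.DirectedClique m :=
  ⟨fun j => c.1 (i.succAbove j),
    c.2.1.comp Fin.succAbove_right_injective,
    fun _ _ h => c.2.2 _ _ (Fin.strictMono_succAbove i h)⟩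

/-- The free `R`-module on the directed `m`-cliques. The degree `k` chain group of the directed
flag chain complex is `FlagChain R G (k + 1)`, for `k ≥ -1`; in degree `-1` it is the free module
on the empty tuple, that is, a copy of `R`. -/
abbrev FlagChain (R : Type) [Ring R] {V : Type} (G : SimpleDigraph V) (m : ℕ) : Type :=
  G.DirectedClique m →₀ R

instance (R : Type) [Ring R] {V : Type} (G : SimpleDigraph V) (m : ℕ) :
    AddCommGroup (FlagChain R G m) :=
  Finsupp.instAddCommGroup

/-- The boundary map `∂ₖ` from degree `k` to degree `k - 1`,
`∂ₖ e_(v₀, …, vₖ) = ∑ᵢ (-1)ⁱ e_(v₀, …, v̂ᵢ, …, vₖ)`.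
For `k = 0` it sums the coefficients (augmentation). -/
def flagBoundary (R : Type) [Ring R] {V : Type} (G : SimpleDigraph V) (k : ℕ) :
    FlagChain R G (k + 1) →ₗ[R] FlagChain R G k :=
  Finsupp.linearCombination R fun c : G.DirectedClique (k + 1) =>
    ∑ i : Fin (k + 1), (-1 : R) ^ (i : ℕ) • Finsupp.single (c.face i) (1 : R)

/-- The boundary maps form a chain complex. -/
theorem flagBoundary_comp (R : Type) [Ring R] {V : Type} (G : SimpleDigraph V) (k : ℕ) :
    flagBoundary R G k ∘ₗ flagBoundary R G (k + 1) = 0 := by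
  refine Finsupp.lhom_ext' fun c => LinearMap.ext_ring ?_
  simp only [flagBoundary, LinearMap.comp_apply, Finsupp.lsingle_apply, LinearMap.zero_apply,
    Finsupp.linearCombination_single, map_sum, map_smul, Finset.smul_sum, smul_smul, one_mul,
    ← pow_add]
  rw [← Fintype.sum_prod_type'
    (f := fun (i : Fin (k + 1 + 1)) (j : Fin (k + 1)) =>
      (-1 : R) ^ ((i : ℕ) + (j : ℕ)) • Finsupp.single ((c.face i).face j) (1 : R))]
  refine Finset.sum_involution (fun x _ => (x.1.succAbove x.2, x.2.predAbove x.1)) ?_ ?_ ?_ ?_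
  · rintro ⟨i, j⟩ -
    have hf : (c.face (i.succAbove j)).face (j.predAbove i) = (c.face i).face j :=
      Subtype.ext (funext fun l =>
        congrArg c.1 (Fin.succAbove_succAbove_succAbove_predAbove i j l))
    simp only [hf, Fin.neg_one_pow_succAbove_add_predAbove]
    rw [neg_smul, add_neg_cancel]
  · rintro ⟨i, j⟩ - - h
    exact Fin.succAbove_ne i j (congrArg Prod.fst h)
  · intro x _
    exact Finset.mem_univ _
  · rintro ⟨i, j⟩ -
    simp [Fin.succAbove_succAbove_predAbove, Fin.predAbove_predAbove_succAbove]

/-- The `k`-th homology group `ker ∂ₖ / im ∂ₖ₊₁` of the directed flag chain complex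
(the image is regarded as a submodule of the kernel). -/
abbrev flagHomology (R : Type) [Ring R] {V : Type} (G : SimpleDigraph V) (k : ℕ) : Type :=
  LinearMap.ker (flagBoundary R G k) ⧸
    (LinearMap.range (flagBoundary R G (k + 1))).submoduleOf (LinearMap.ker (flagBoundary R G k))

/-- The `k`-th Betti number of the directed flag complex with coefficients in `R`: the rank of the
`k`-th homology group. -/
def flagBetti {V : Type} (G : SimpleDigraph V) (R : Type) [Ring R] (k : ℕ) : ℕ :=
  Module.finrank R (flagHomology R G k)

end SimpleDigraph

/-! ### The Erdős–Rényi random directed graph on `n` labelled nodes -/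

namespace RandomDigraph

/-- The probability with which a given digraph on `n` nodes appears. -/
def weight (n : ℕ) (p : ℝ) (G : SimpleDigraph (Fin n)) : ℝ :=
  p ^ G.edges.card * (1 - p) ^ (n * (n - 1) - G.edges.card)

/-- The expectation of a random variable on the model with `n` nodes and edge probability `p`. -/
def expectation (n : ℕ) (p : ℝ) (X : SimpleDigraph (Fin n) → ℝ) : ℝ :=
  ∑ G : SimpleDigraph (Fin n), weight n p G * X G

/-- The probability of an event in the model with `n` nodes and edge probability `p`. -/
def prob (n : ℕ) (p : ℝ) (A : Set (SimpleDigraph (Fin n))) : ℝ :=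
  expectation n p (A.indicator 1)

theorem weight_nonneg (n : ℕ) (p : ℝ) (hp : p ∈ Set.Icc (0 : ℝ) 1) (G : SimpleDigraph (Fin n)) :
    0 ≤ weight n p G :=
  mul_nonneg (pow_nonneg hp.1 _) (pow_nonneg (sub_nonneg.2 hp.2) _)

/-- The probabilities of all digraphs add up to one. -/
theorem sum_weight (n : ℕ) (p : ℝ) : ∑ G : SimpleDigraph (Fin n), weight n p G = 1 := by
  have h := Finset.sum_pow_mul_eq_add_pow p (1 - p) (Finset.univ : Finset (Fin n)).offDiag
  rw [show p + (1 - p) = 1 by ring, one_pow, Finset.offDiag_card, Finset.card_univ,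
    Fintype.card_fin] at h
  rw [← h]
  refine Finset.sum_bij (fun G _ => G.1) ?_ ?_ ?_ ?_
  · intro G _
    rw [Finset.mem_powerset]
    intro e he
    simpa [Finset.mem_offDiag] using G.2 e he
  · intro G _ H _ e
    exact Subtype.ext e
  · intro E hE
    rw [Finset.mem_powerset] at hE
    exact ⟨⟨E, fun e he => (Finset.mem_offDiag.1 (hE he)).2.2⟩, Finset.mem_univ _, rfl⟩
  · intro G _
    unfold weight SimpleDigraph.edges
    rw [Nat.mul_sub, Nat.mul_one]

end RandomDigraph

end

noncomputable section

namespace SimpleDigraph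

/-! Write `c_m` for the number of directed `m`-cliques. Rank-nullity gives `c_{k+1} - c_k - c_{k+2}
≤ β_k ≤ c_{k+1}` (`cliqueCount_le_flagBetti_add`, `flagBetti_le_cliqueCount`). The ratio `E c_{m+1}
/ E c_m` is `(n - m) p ^ m`, so if `n p ^ k → ∞` and `n p ^ (k+1) → 0`, then `c_{k+1}` dominates its
neighbours on average and `E β_k ~ E c_{k+1}`. For `k = 1`, Chebyshev for the number of edges and
Markov for `c_3` turn this into `β_1 > 0` with high probability.

In the sparse regime, a nonzero 1-cycle is supported on a subgraph of minimum degree at least 2,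
which has at least as many edges as vertices (`exists_offDiag_subset_of_flagBetti_ne_zero`). A union
bound over such subgraphs is a geometric series in `e ^ 2 n p`.

In the dense regime, if any four vertices have a common out-neighbour, then every edge is, modulo
boundaries, a difference of vertex potentials. The projection onto chains modulo boundaries then
factors through `∂₁`, and every cycle is a boundary (`flagBetti_one_eq_zero`). The property fails
with probability at most `n ^ 4 (1 - p ^ 4) ^ (n - 4)`. -/

instance {V : Type} [Finite V] (G : SimpleDigraph V) (m : ℕ) : Finite (G.DirectedClique m) :=
  Subtype.finite

/-- The number of directed `m`-cliques. -/
def cliqueCount {V : Type} (G : SimpleDigraph V) (m : ℕ) : ℕ :=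
  Nat.card (G.DirectedClique m)

theorem ne_of_mem_edges {V : Type} {G : SimpleDigraph V} {a b : V} (h : (a, b) ∈ G.edges) :
    a ≠ b :=
  G.2 _ h

/-! ### Bounds for Betti numbers by numbers of cliques -/

theorem finrank_flagChain {V : Type} [Finite V] (G : SimpleDigraph V) (m : ℕ) :
    Module.finrank ℤ (FlagChain ℤ G m) = G.cliqueCount m := by
  have := Fintype.ofFinite (G.DirectedClique m)
  rw [cliqueCount, Nat.card_eq_fintype_card]
  exact Module.finrank_finsupp_self ℤ

theorem finrank_range_add_finrank_ker_int {M N : Type} [AddCommGroup M] [AddCommGroup N]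
    [Module.Finite ℤ M] (f : M →ₗ[ℤ] N) :
    Module.finrank ℤ (LinearMap.range f) + Module.finrank ℤ (LinearMap.ker f) =
      Module.finrank ℤ M := by
  rw [← f.quotKerEquivRange.finrank_eq]
  exact Submodule.finrank_quotient_add_finrank _

/-- Rank is additive for quotients over the domain ℤ, so torsion in the homology plays no role. -/
theorem flagBetti_add_finrank_range {V : Type} [Finite V] (G : SimpleDigraph V) (k : ℕ) :
    G.flagBetti ℤ k + Module.finrank ℤ (LinearMap.range (flagBoundary ℤ G (k + 1))) =
      Module.finrank ℤ (LinearMap.ker (flagBoundary ℤ G k)) := by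
  have hle : LinearMap.range (flagBoundary ℤ G (k + 1)) ≤ LinearMap.ker (flagBoundary ℤ G k) :=
    LinearMap.range_le_ker_iff.2 (flagBoundary_comp ℤ G k)
  rw [← (Submodule.submoduleOfEquivOfLe hle).finrank_eq]
  exact Submodule.finrank_quotient_add_finrank _

theorem flagBetti_le_cliqueCount {V : Type} [Finite V] (G : SimpleDigraph V) (k : ℕ) :
    G.flagBetti ℤ k ≤ G.cliqueCount (k + 1) := by
  have h₁ := G.flagBetti_add_finrank_range k
  have h₂ := Submodule.finrank_le (LinearMap.ker (flagBoundary ℤ G k))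
  rw [finrank_flagChain] at h₂
  lia

/-- The chains of degree `k` have rank `β_k` plus the ranks of `∂ₖ` and `∂ₖ₊₁`; the former is
bounded by its target, the latter by its source. -/
theorem cliqueCount_le_flagBetti_add {V : Type} [Finite V] (G : SimpleDigraph V) (k : ℕ) :
    G.cliqueCount (k + 1) ≤ G.flagBetti ℤ k + G.cliqueCount k + G.cliqueCount (k + 2) := by
  have h₁ := G.flagBetti_add_finrank_range k
  have h₂ := finrank_range_add_finrank_ker_int (flagBoundary ℤ G k)
  have h₃ := Submodule.finrank_le (LinearMap.range (flagBoundary ℤ G k))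
  have h₄ := LinearMap.finrank_range_le (flagBoundary ℤ G (k + 1))
  rw [finrank_flagChain] at h₂ h₃ h₄
  lia

theorem flagBetti_eq_zero_of_ker_le_range {V : Type} (G : SimpleDigraph V) (k : ℕ)
    (h : LinearMap.ker (flagBoundary ℤ G k) ≤ LinearMap.range (flagBoundary ℤ G (k + 1))) :
    G.flagBetti ℤ k = 0 := by
  have : Subsingleton (flagHomology ℤ G k) :=
    Submodule.Quotient.subsingleton_iff.2 (Submodule.submoduleOf_eq_top.2 h)
  exact Module.finrank_zero_of_subsingleton

/-! ### Cycles in sparse digraphs -/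

theorem flagBoundary_one_single {V : Type} (R : Type) [Ring R] (G : SimpleDigraph V)
    (c : G.DirectedClique 2) :
    flagBoundary R G 1 (Finsupp.single c 1) =
      Finsupp.single (c.face 0) 1 - Finsupp.single (c.face 1) 1 := by
  simp [flagBoundary, Fin.sum_univ_two, sub_eq_add_neg]

theorem flagBoundary_one_apply {V : Type} [DecidableEq V] (G : SimpleDigraph V)
    (z : FlagChain ℤ G 2) (u : G.DirectedClique 1) :
    flagBoundary ℤ G 1 z u = ∑ c ∈ z.support,
      z c * ((if c.1 1 = u.1 0 then 1 else 0) - (if c.1 0 = u.1 0 then 1 else 0)) := by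
  have key (c : G.DirectedClique 2) (i : Fin 2) :
      Finsupp.single (c.face i) (1 : ℤ) u = if c.1 (i.succAbove 0) = u.1 0 then 1 else 0 := by
    classical
    rw [Finsupp.single_apply]
    refine if_congr ⟨fun h => h ▸ rfl, fun h => Subtype.ext (funext fun j => ?_)⟩ rfl rfl
    rw [Subsingleton.elim j 0]
    exact h
  rw [flagBoundary, Finsupp.linearCombination_apply, Finsupp.sum, Finsupp.finsetSum_apply]
  refine Finset.sum_congr rfl fun c _ => ?_
  rw [Fin.sum_univ_two]
  simp only [Finsupp.smul_apply, Finsupp.add_apply, key, smul_eq_mul]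
  split_ifs <;> simp_all

/-- The vertices of a nonzero `1`-cycle span at least as many edges as there are of them. -/
theorem exists_offDiag_subset_of_flagBetti_ne_zero {V : Type} [DecidableEq V] (G : SimpleDigraph V)
    (h : G.flagBetti ℤ 1 ≠ 0) :
    ∃ (S : Finset V) (T : Finset (V × V)),
      S.Nonempty ∧ T ⊆ S.offDiag ∧ T.card = S.card ∧ T ⊆ G.edges := by
  obtain ⟨z, hz, hz0⟩ : ∃ z : FlagChain ℤ G 2, flagBoundary ℤ G 1 z = 0 ∧ z ≠ 0 := by
    by_contra! hc
    refine h (G.flagBetti_eq_zero_of_ker_le_range 1 fun z hz => ?_)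
    rw [hc z hz]
    exact zero_mem _
  have hne (c : G.DirectedClique 2) : c.1 0 ≠ c.1 1 := fun h => by simpa using c.2.1 h
  let ed : G.DirectedClique 2 → V × V := fun c => (c.1 0, c.1 1)
  have hinj : Function.Injective ed := fun c d hcd => by
    have h₁ := Prod.ext_iff.1 hcd
    refine Subtype.ext (funext fun j => ?_)
    fin_cases j
    exacts [h₁.1, h₁.2]
  let H := z.support.image ed
  let S := H.image Prod.fst ∪ H.image Prod.snd
  have hHG : H ⊆ G.edges := fun e he => by
    obtain ⟨c, -, rfl⟩ := Finset.mem_image.1 he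
    exact c.2.2 0 1 (by decide)
  have hHS : H ⊆ S.offDiag := fun e he => by
    refine Finset.mem_offDiag.2 ⟨Finset.mem_union_left _ (Finset.mem_image_of_mem _ he),
      Finset.mem_union_right _ (Finset.mem_image_of_mem _ he), G.2 e (hHG he)⟩
  -- If only one edge `c` of the support met `u`, the coefficient of `∂z` at `u` would be `± z c ≠
  -- 0`. Opposite edges count separately.
  have hdeg : ∀ u ∈ S, 2 ≤ (H.bipartiteBelow (fun e u => e.1 = u ∨ e.2 = u) u).card := by
    intro u hu
    obtain ⟨c, hc, hcu⟩ : ∃ c ∈ z.support, c.1 0 = u ∨ c.1 1 = u := by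
      simp only [S, H, Finset.mem_union, Finset.mem_image] at hu
      rcases hu with ⟨_, ⟨c, hc, rfl⟩, rfl⟩ | ⟨_, ⟨c, hc, rfl⟩, rfl⟩
      exacts [⟨c, hc, .inl rfl⟩, ⟨c, hc, .inr rfl⟩]
    obtain ⟨d, hd, hdu, hdc⟩ : ∃ d ∈ z.support, (d.1 0 = u ∨ d.1 1 = u) ∧ d ≠ c := by
      by_contra! hall
      obtain ⟨u', rfl⟩ : ∃ u' : G.DirectedClique 1, u'.1 0 = u :=
        ⟨⟨fun _ => u, fun i j _ => Subsingleton.elim i j, fun i j hij => by lia⟩, rfl⟩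
      have h₁ : (0 : ℤ) = _ :=
        (congrArg (fun y : FlagChain ℤ G 1 => y u') hz).symm.trans (G.flagBoundary_one_apply z u')
      rw [Finset.sum_eq_single c] at h₁
      · have h₂ := hne c
        have h₃ := Finsupp.mem_support_iff.1 hc
        rcases hcu with h | h <;> simp [← h, h₂, h₂.symm, h₃, eq_comm (a := (0 : ℤ))] at h₁
      · intro d hd hdc
        have h₂ : ¬(d.1 0 = u'.1 0 ∨ d.1 1 = u'.1 0) := fun h => hdc (hall d hd h)
        rw [not_or] at h₂
        simp [h₂.1, h₂.2]
      · exact fun h => absurd hc h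
    refine Finset.one_lt_card.2 ⟨ed c, ?_, ed d, ?_, fun h => hdc (hinj h).symm⟩
    · exact Finset.mem_filter.2 ⟨Finset.mem_image_of_mem _ hc, hcu⟩
    · exact Finset.mem_filter.2 ⟨Finset.mem_image_of_mem _ hd, hdu⟩
  -- Double counting of incidences: at least 2 per vertex, at most 2 per edge.
  have hcard : S.card ≤ H.card := by
    have h₁ := Finset.card_nsmul_le_sum S _ 2 hdeg
    rw [← Finset.sum_card_bipartiteAbove_eq_sum_card_bipartiteBelow] at h₁
    have h₂ := Finset.sum_le_card_nsmul H
      (fun e => (S.bipartiteAbove (fun e u => e.1 = u ∨ e.2 = u) e).card) 2 fun e _ => by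
        refine (Finset.card_le_card (t := {e.1, e.2}) fun u hu => ?_).trans Finset.card_le_two
        rcases (Finset.mem_filter.1 hu).2 with h | h <;> simp [← h]
    simp only [smul_eq_mul] at h₁ h₂
    lia
  -- Surplus edges are discarded so that the union bound only needs sets of exactly `|S|` edges.
  obtain ⟨T, hTH, hT⟩ := Finset.exists_subset_card_eq hcard
  refine ⟨S, T, ?_, hTH.trans hHS, hT, hTH.trans hHG⟩
  obtain ⟨c, hc⟩ := Finsupp.support_nonempty_iff.2 hz0
  exact ⟨c.1 0, Finset.mem_union_left _
    (Finset.mem_image_of_mem _ (Finset.mem_image_of_mem ed hc))⟩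

/-! ### Common out-neighbours -/

/-- The directed `2`-clique given by an edge. -/
def edgeClique {V : Type} {G : SimpleDigraph V} {a b : V} (h : (a, b) ∈ G.edges) :
    G.DirectedClique 2 :=
  ⟨![a, b], by
    intro i j hij
    have := ne_of_mem_edges h
    fin_cases i <;> fin_cases j <;> simp_all, by
    intro i j hij
    fin_cases i <;> fin_cases j <;> simp_all⟩

/-- The directed `3`-clique given by a transitive triangle. -/
def triangleClique {V : Type} {G : SimpleDigraph V} {a b c : V} (hab : (a, b) ∈ G.edges)
    (hbc : (b, c) ∈ G.edges) (hac : (a, c) ∈ G.edges) : G.DirectedClique 3 :=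
  ⟨![a, b, c], by
    intro i j hij
    have := ne_of_mem_edges hab
    have := ne_of_mem_edges hbc
    have := ne_of_mem_edges hac
    fin_cases i <;> fin_cases j <;> simp_all, by
    intro i j hij
    fin_cases i <;> fin_cases j <;> simp_all⟩

/-- The class of an edge modulo boundaries. -/
def edgeClass {V : Type} {G : SimpleDigraph V} {a b : V} (h : (a, b) ∈ G.edges) :
    FlagChain ℤ G 2 ⧸ LinearMap.range (flagBoundary ℤ G 2) :=
  (LinearMap.range (flagBoundary ℤ G 2)).mkQ (Finsupp.single (edgeClique h) 1)

/-- The boundary `bc - ac + ab` of the triangle vanishes in the quotient. -/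
theorem edgeClass_eq_sub {V : Type} {G : SimpleDigraph V} {a b c : V} (hab : (a, b) ∈ G.edges)
    (hbc : (b, c) ∈ G.edges) (hac : (a, c) ∈ G.edges) :
    edgeClass hab = edgeClass hac - edgeClass hbc := by
  have h₀ : (triangleClique hab hbc hac).face 0 = edgeClique hbc :=
    Subtype.ext (funext fun i => by fin_cases i <;> rfl)
  have h₁ : (triangleClique hab hbc hac).face 1 = edgeClique hac :=
    Subtype.ext (funext fun i => by fin_cases i <;> rfl)
  have h₂ : (triangleClique hab hbc hac).face 2 = edgeClique hab :=
    Subtype.ext (funext fun i => by fin_cases i <;> rfl)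
  rw [edgeClass, edgeClass, edgeClass, ← map_sub, ← sub_eq_zero, ← map_sub, Submodule.mkQ_apply,
    Submodule.Quotient.mk_eq_zero]
  refine ⟨Finsupp.single (triangleClique hab hbc hac) 1, ?_⟩
  rw [flagBoundary, Finsupp.linearCombination_single, one_smul, Fin.sum_univ_three, h₀, h₁, h₂]
  simp
  abel

/-- If any four vertices have a common out-neighbour, the first homology group vanishes. -/
theorem flagBetti_one_eq_zero {V : Type} (G : SimpleDigraph V)
    (h : ∀ a b c d : V, ∃ v, (a, v) ∈ G.edges ∧ (b, v) ∈ G.edges ∧ (c, v) ∈ G.edges ∧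
      (d, v) ∈ G.edges) : G.flagBetti ℤ 1 = 0 := by
  refine G.flagBetti_eq_zero_of_ker_le_range 1 fun z hz => ?_
  rcases isEmpty_or_nonempty V with hV | ⟨⟨o⟩⟩
  · have : IsEmpty (G.DirectedClique 2) := ⟨fun c => hV.elim (c.1 0)⟩
    rw [Subsingleton.elim z 0]
    exact zero_mem _
  -- The potential of `v` is the class of the path `o → w v ← v` from a fixed base point `o`.
  choose w how hw using fun v : V =>
    (show ∃ w, (o, w) ∈ G.edges ∧ (v, w) ∈ G.edges from
      let ⟨w, h₁, h₂, _⟩ := h o v o o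
      ⟨w, h₁, h₂⟩)
  -- The path class does not depend on its middle vertex: a common out-neighbour `y` of `o, b, x, w`
  -- deforms both paths to `o → y ← b`. This is where four vertices are needed.
  have hpath {b x w : V} (hox : (o, x) ∈ G.edges) (hbx : (b, x) ∈ G.edges) (how : (o, w) ∈ G.edges)
      (hbw : (b, w) ∈ G.edges) :
      edgeClass hox - edgeClass hbx = edgeClass how - edgeClass hbw := by
    obtain ⟨y, hoy, hby, hxy, hwy⟩ := h o b x w
    rw [edgeClass_eq_sub hox hxy hoy, edgeClass_eq_sub hbx hxy hby, edgeClass_eq_sub how hwy hoy,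
      edgeClass_eq_sub hbw hwy hby]
    abel
  -- With a common out-neighbour `x` of `o, a, b`, both potentials can be computed through `x`; the
  -- edges from `o` cancel and the triangle `a, b, x` remains.
  have hedge {a b : V} (hab : (a, b) ∈ G.edges) : edgeClass hab =
      (edgeClass (how b) - edgeClass (hw b)) - (edgeClass (how a) - edgeClass (hw a)) := by
    obtain ⟨x, hox, hax, hbx, -⟩ := h o a b o
    rw [hpath (how a) (hw a) hox hax, hpath (how b) (hw b) hox hbx, edgeClass_eq_sub hab hbx hax]
    abel
  let ψ : FlagChain ℤ G 1 →ₗ[ℤ] FlagChain ℤ G 2 ⧸ LinearMap.range (flagBoundary ℤ G 2) :=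
    Finsupp.linearCombination ℤ fun u => edgeClass (how (u.1 0)) - edgeClass (hw (u.1 0))
  have hψ : (LinearMap.range (flagBoundary ℤ G 2)).mkQ = ψ ∘ₗ flagBoundary ℤ G 1 := by
    refine Finsupp.lhom_ext' fun c => LinearMap.ext_ring ?_
    have hc : c = edgeClique (c.2.2 0 1 (by decide)) :=
      Subtype.ext (funext fun i => by fin_cases i <;> rfl)
    rw [LinearMap.comp_apply, LinearMap.comp_apply, Finsupp.lsingle_apply, LinearMap.comp_apply,
      flagBoundary_one_single, map_sub, Finsupp.linearCombination_single,
      Finsupp.linearCombination_single, one_smul, one_smul]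
    conv_lhs => rw [hc]
    exact hedge (c.2.2 0 1 (by decide))
  rw [← Submodule.Quotient.mk_eq_zero, ← Submodule.mkQ_apply, hψ, LinearMap.comp_apply,
    LinearMap.mem_ker.1 hz, map_zero]

end SimpleDigraph

/-! ### Cliques as sets of required edges -/

namespace SimpleDigraph

theorem edges_subset_offDiag {V : Type} [Fintype V] [DecidableEq V] (G : SimpleDigraph V) :
    G.edges ⊆ (Finset.univ : Finset V).offDiag :=
  fun e he => by simpa [Finset.mem_offDiag] using G.2 e he

/-- The pairs of vertices that have to be edges for the tuple `v` to be a directed clique. -/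
def cliqueEdges {n m : ℕ} (v : Fin m ↪ Fin n) : Finset (Fin n × Fin n) :=
  (Finset.univ.filter fun x : Fin m × Fin m => x.1 < x.2).map (v.prodMap v)

theorem cliqueEdges_subset_offDiag {n m : ℕ} (v : Fin m ↪ Fin n) :
    cliqueEdges v ⊆ (Finset.univ : Finset (Fin n)).offDiag := by
  intro e he
  obtain ⟨x, hx, rfl⟩ := Finset.mem_map.1 he
  have := (Finset.mem_filter.1 hx).2.ne
  simpa [Finset.mem_offDiag] using this

theorem card_cliqueEdges {n m : ℕ} (v : Fin m ↪ Fin n) : (cliqueEdges v).card = m.choose 2 := by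
  rw [cliqueEdges, Finset.card_map, Finset.card_filter, Fintype.sum_prod_type_right]
  have (j : Fin m) : ∑ i : Fin m, (if i < j then 1 else 0) = (j : ℕ) := by
    rw [← Finset.card_filter, Finset.filter_gt_eq_Iio, Fin.card_Iio]
  simp only [this]
  rw [Fin.sum_univ_eq_sum_range (fun i => i), Finset.sum_range_id, Nat.choose_two_right]

theorem cliqueCount_eq_sum {n : ℕ} (G : SimpleDigraph (Fin n)) (m : ℕ) :
    G.cliqueCount m = ∑ v : Fin m ↪ Fin n, if cliqueEdges v ⊆ G.edges then 1 else 0 := by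
  rw [← Finset.card_filter, cliqueCount, ← Fintype.card_subtype, ← Nat.card_eq_fintype_card]
  refine Nat.card_congr ⟨fun c => ⟨⟨c.1, c.2.1⟩, ?_⟩, fun v => ⟨v.1, v.1.injective, ?_⟩,
    fun _ => rfl, fun _ => rfl⟩
  · intro e he
    obtain ⟨x, hx, rfl⟩ := Finset.mem_map.1 he
    exact c.2.2 _ _ (Finset.mem_filter.1 hx).2
  · intro i j hij
    exact v.2 (Finset.mem_map.2 ⟨(i, j), by simpa using hij, rfl⟩)

theorem cliqueCount_one_le {n : ℕ} (G : SimpleDigraph (Fin n)) : G.cliqueCount 1 ≤ n := by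
  have h : Function.Injective fun c : G.DirectedClique 1 => c.1 0 := fun c d hcd =>
    Subtype.ext (funext fun j => by rw [Subsingleton.elim j 0]; exact hcd)
  simpa [cliqueCount] using Nat.card_le_card_of_injective _ h

theorem card_edges_le_cliqueCount_two {n : ℕ} (G : SimpleDigraph (Fin n)) :
    G.edges.card ≤ G.cliqueCount 2 := by
  have h : Function.Injective fun e : {e // e ∈ G.edges} =>
      edgeClique (a := e.1.1) (b := e.1.2) e.2 := by
    rintro ⟨⟨a, b⟩, h⟩ ⟨⟨c, d⟩, h'⟩ hcd
    have h₀ := congrFun (Subtype.ext_iff.1 hcd) 0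
    have h₁ := congrFun (Subtype.ext_iff.1 hcd) 1
    simp only [edgeClique, Matrix.cons_val_zero, Matrix.cons_val_one] at h₀ h₁
    simp [h₀, h₁]
  simpa [cliqueCount] using Nat.card_le_card_of_injective _ h

end SimpleDigraph

namespace RandomDigraph

/-! ### Expectations and probabilities -/

theorem expectation_add (n : ℕ) (p : ℝ) (X Y : SimpleDigraph (Fin n) → ℝ) :
    expectation n p (fun G => X G + Y G) = expectation n p X + expectation n p Y := by
  simp only [expectation, mul_add, Finset.sum_add_distrib]

theorem expectation_const_mul (n : ℕ) (p c : ℝ) (X : SimpleDigraph (Fin n) → ℝ) :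
    expectation n p (fun G => c * X G) = c * expectation n p X := by
  simp only [expectation, Finset.mul_sum, mul_left_comm]

theorem expectation_sum {ι : Type} (n : ℕ) (p : ℝ) (s : Finset ι)
    (X : ι → SimpleDigraph (Fin n) → ℝ) :
    expectation n p (fun G => ∑ i ∈ s, X i G) = ∑ i ∈ s, expectation n p (X i) := by
  simp only [expectation, Finset.mul_sum]
  exact Finset.sum_comm

theorem expectation_const (n : ℕ) (p c : ℝ) : expectation n p (fun _ => c) = c := by
  rw [expectation, ← Finset.sum_mul, sum_weight, one_mul]

theorem expectation_mono {n : ℕ} {p : ℝ} (hp : p ∈ Set.Icc (0 : ℝ) 1)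
    {X Y : SimpleDigraph (Fin n) → ℝ} (h : ∀ G, X G ≤ Y G) :
    expectation n p X ≤ expectation n p Y :=
  Finset.sum_le_sum fun G _ => mul_le_mul_of_nonneg_left (h G) (weight_nonneg n p hp G)

theorem prob_nonneg {n : ℕ} {p : ℝ} (hp : p ∈ Set.Icc (0 : ℝ) 1)
    (A : Set (SimpleDigraph (Fin n))) : 0 ≤ prob n p A :=
  Finset.sum_nonneg fun G _ => mul_nonneg (weight_nonneg n p hp G)
    (Set.indicator_nonneg (fun _ _ => zero_le_one) G)

theorem prob_add_prob_compl (n : ℕ) (p : ℝ) (A : Set (SimpleDigraph (Fin n))) :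
    prob n p A + prob n p Aᶜ = 1 := by
  rw [prob, prob, ← expectation_add, ← expectation_const n p 1]
  congr 1
  funext G
  exact congrFun (Set.indicator_self_add_compl A (1 : SimpleDigraph (Fin n) → ℝ)) G

/-- The common form of Markov, Chebyshev and union bounds below: each is a choice of the test
variable `X`. -/
theorem prob_le_expectation {n : ℕ} {p : ℝ} (hp : p ∈ Set.Icc (0 : ℝ) 1)
    {A : Set (SimpleDigraph (Fin n))} {X : SimpleDigraph (Fin n) → ℝ} (h₀ : ∀ G, 0 ≤ X G)
    (h₁ : ∀ G ∈ A, 1 ≤ X G) : prob n p A ≤ expectation n p X :=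
  expectation_mono hp fun G => Set.indicator_le' (f := 1) (g := X) (fun G hG => h₁ G hG)
    (fun G _ => h₀ G) G

theorem expectation_subset_edges {n : ℕ} (p : ℝ) {T : Finset (Fin n × Fin n)}
    (hT : T ⊆ (Finset.univ : Finset (Fin n)).offDiag) :
    expectation n p (fun G => if T ⊆ G.edges then 1 else 0) = p ^ T.card := by
  set D := (Finset.univ : Finset (Fin n)).offDiag with hD
  have hDcard : D.card = n * (n - 1) := by
    rw [hD, Finset.offDiag_card, Finset.card_univ, Fintype.card_fin, Nat.mul_sub, Nat.mul_one]
  -- Expanding this product over subsets of `D` gives the sum over digraphs: the factor 0 at `e ∈ T`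
  -- kills exactly those that miss an edge of `T`.
  have h₁ : ∏ e ∈ D, (p + if e ∈ T then 0 else 1 - p) = p ^ T.card := by
    have (e : Fin n × Fin n) : (p + if e ∈ T then 0 else 1 - p) = if e ∈ T then p else 1 := by
      split_ifs <;> ring
    simp only [this]
    rw [Finset.prod_ite_mem, Finset.inter_eq_right.2 hT, Finset.prod_const]
  rw [← h₁, Finset.prod_add, expectation]
  refine Finset.sum_bij (fun G _ => G.1) (fun G _ => Finset.mem_powerset.2 G.edges_subset_offDiag)
    (fun G _ H _ e => Subtype.ext e) (fun E hE => ?_) fun G _ => ?_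
  · rw [Finset.mem_powerset] at hE
    exact ⟨⟨E, fun e he => (Finset.mem_offDiag.1 (hE he)).2.2⟩, Finset.mem_univ _, rfl⟩
  · rw [weight, mul_assoc, Finset.prod_const]
    congr 1
    by_cases h : T ⊆ G.edges
    · rw [if_pos h, mul_one, ← hDcard, ← Finset.card_sdiff_of_subset G.edges_subset_offDiag]
      refine (Finset.prod_eq_pow_card fun e he => if_neg fun heT => ?_).symm
      exact (Finset.mem_sdiff.1 he).2 (h heT)
    · obtain ⟨e, heT, heG⟩ := Finset.not_subset.1 h
      rw [if_neg h, mul_zero]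
      refine (Finset.prod_eq_zero (i := e) (Finset.mem_sdiff.2 ⟨hT heT, heG⟩) ?_).symm
      exact if_pos heT

theorem expectation_cliqueCount (n m : ℕ) (p : ℝ) :
    expectation n p (fun G => (G.cliqueCount m : ℝ)) =
      (n.descFactorial m : ℝ) * p ^ m.choose 2 := by
  simp only [SimpleDigraph.cliqueCount_eq_sum, Nat.cast_sum, Nat.cast_ite, Nat.cast_one,
    Nat.cast_zero]
  rw [expectation_sum]
  simp only [expectation_subset_edges p (SimpleDigraph.cliqueEdges_subset_offDiag _),
    SimpleDigraph.card_cliqueEdges, Finset.sum_const, Finset.card_univ,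
    Fintype.card_embedding_eq, Fintype.card_fin, nsmul_eq_mul]

/-- The variance of the number of edges. -/
theorem expectation_card_edges_sub_sq (n : ℕ) (p : ℝ) :
    expectation n p (fun G => ((G.edges.card : ℝ) - (n * (n - 1) : ℕ) * p) ^ 2) =
      (n * (n - 1) : ℕ) * (p * (1 - p)) := by
  set D := (Finset.univ : Finset (Fin n)).offDiag with hD
  have hDcard : D.card = n * (n - 1) := by
    rw [hD, Finset.offDiag_card, Finset.card_univ, Fintype.card_fin, Nat.mul_sub, Nat.mul_one]
  rw [← hDcard]
  have hsum (G : SimpleDigraph (Fin n)) :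
      (G.edges.card : ℝ) = ∑ e ∈ D, if {e} ⊆ G.edges then 1 else 0 := by
    rw [← Finset.sum_filter]
    simp only [Finset.singleton_subset_iff]
    rw [Finset.filter_mem_eq_inter, Finset.inter_eq_right.2 G.edges_subset_offDiag]
    simp
  have hsq (G : SimpleDigraph (Fin n)) :
      (G.edges.card : ℝ) ^ 2 = ∑ e ∈ D, ∑ f ∈ D, if {e, f} ⊆ G.edges then 1 else 0 := by
    rw [sq, hsum, Finset.sum_mul_sum]
    refine Finset.sum_congr rfl fun e _ => Finset.sum_congr rfl fun f _ => ?_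
    simp only [Finset.singleton_subset_iff, Finset.insert_subset_iff, ite_and]
    split_ifs <;> simp
  have h₁ : expectation n p (fun G => (G.edges.card : ℝ)) = D.card * p := by
    simp only [hsum]
    rw [expectation_sum, Finset.sum_congr rfl fun e he => expectation_subset_edges p
      (Finset.singleton_subset_iff.2 he)]
    simp only [Finset.card_singleton, pow_one, Finset.sum_const, nsmul_eq_mul]
    rw [hD]
  have h₂ : expectation n p (fun G => (G.edges.card : ℝ) ^ 2) =
      D.card * (p * (1 - p)) + (D.card * p) ^ 2 := by
    simp only [hsq]
    rw [expectation_sum]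
    have (e) (he : e ∈ D) : expectation n p (fun G => ∑ f ∈ D, if {e, f} ⊆ G.edges then 1 else 0) =
        p * (1 - p) + D.card * p ^ 2 := by
      rw [expectation_sum]
      -- For `e = f` the pair collapses to one edge, with probability `p = p (1 - p) + p ^ 2`.
      have (f) (hf : f ∈ D) : expectation n p (fun G => if {e, f} ⊆ G.edges then 1 else 0) =
          (if e = f then p * (1 - p) else 0) + p ^ 2 := by
        rw [expectation_subset_edges p (Finset.insert_subset he (Finset.singleton_subset_iff.2 hf))]
        split_ifs with h
        · simp [h]
          ring
        · simp [Finset.card_pair h]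
      rw [Finset.sum_congr rfl this, Finset.sum_add_distrib]
      simp [he]
    rw [Finset.sum_congr rfl this]
    simp
    ring
  have h₃ (G : SimpleDigraph (Fin n)) : ((G.edges.card : ℝ) - D.card * p) ^ 2 =
      (G.edges.card : ℝ) ^ 2 + (-(2 * (D.card * p)) * (G.edges.card : ℝ) + (D.card * p) ^ 2) := by
    ring
  simp only [h₃]
  rw [expectation_add, expectation_add, expectation_const_mul, expectation_const, h₁, h₂]
  ring

/-- Independence of events on disjoint edge sets: after expanding both products, each term asks for
a union of sets whose cardinalities add up. -/
theorem expectation_prod_one_sub {ι : Type} {n : ℕ} (p : ℝ) (s : Finset ι)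
    (T : ι → Finset (Fin n × Fin n))
    (hT : ∀ i ∈ s, T i ⊆ (Finset.univ : Finset (Fin n)).offDiag)
    (hdisj : (s : Set ι).PairwiseDisjoint T) :
    expectation n p (fun G => ∏ i ∈ s, (1 - if T i ⊆ G.edges then 1 else 0)) =
      ∏ i ∈ s, (1 - p ^ (T i).card) := by
  classical
  simp only [sub_eq_add_neg, Finset.prod_one_add, Finset.prod_neg]
  rw [expectation_sum]
  refine Finset.sum_congr rfl fun t ht => ?_
  rw [Finset.mem_powerset] at ht
  rw [expectation_const_mul]
  congr 1
  have h (G : SimpleDigraph (Fin n)) : ∏ i ∈ t, (if T i ⊆ G.edges then (1 : ℝ) else 0) =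
      if t.biUnion T ⊆ G.edges then 1 else 0 := by
    rw [Finset.prod_ite_zero, Finset.prod_const_one]
    simp only [Finset.biUnion_subset]
  simp only [h]
  rw [expectation_subset_edges p (Finset.biUnion_subset.2 fun i hi => hT i (ht hi)),
    Finset.card_biUnion (hdisj.subset ht), Finset.prod_pow_eq_pow_sum]

/-! ### Bounds for the probabilities of events -/

theorem prob_not_commonOutNeighbour_le {n : ℕ} {p : ℝ} (hp : p ∈ Set.Icc (0 : ℝ) 1) :
    prob n p {G | ¬∀ a b c d : Fin n, ∃ v, (a, v) ∈ G.edges ∧ (b, v) ∈ G.edges ∧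
      (c, v) ∈ G.edges ∧ (d, v) ∈ G.edges} ≤ (n : ℝ) ^ 4 * (1 - p ^ 4) ^ (n - 4) := by
  let S : Fin n × Fin n × Fin n × Fin n → Finset (Fin n) :=
    fun x => {x.1, x.2.1, x.2.2.1, x.2.2.2}
  -- `T x v` joins every entry of `x` to `v`. Taking `v` outside `S x` excludes loops, and distinct
  -- `v` give disjoint sets; repeated entries only make `S x` smaller.
  let T : Fin n × Fin n × Fin n × Fin n → Fin n → Finset (Fin n × Fin n) :=
    fun x v => S x ×ˢ {v}
  have hS x : (S x).card ≤ 4 := Finset.card_le_four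
  have h01 (x) (v) (G : SimpleDigraph (Fin n)) :
      (0 : ℝ) ≤ 1 - if T x v ⊆ G.edges then 1 else 0 := by
    split_ifs <;> simp
  have hnonneg (x) (G : SimpleDigraph (Fin n)) :
      (0 : ℝ) ≤ ∏ v ∈ (S x)ᶜ, (1 - if T x v ⊆ G.edges then 1 else 0) :=
    Finset.prod_nonneg fun v _ => h01 x v G
  refine (prob_le_expectation hp (X := fun G => ∑ x, ∏ v ∈ (S x)ᶜ,
    (1 - if T x v ⊆ G.edges then 1 else 0)) (fun G => Finset.sum_nonneg fun x _ => hnonneg x G)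
    fun G hG => ?_).trans ?_
  · simp only [Set.mem_ofPred_eq, not_forall] at hG
    obtain ⟨a, b, c, d, h⟩ := hG
    refine le_of_eq_of_le (Eq.symm ?_) (Finset.single_le_sum (fun x _ => hnonneg x G)
      (Finset.mem_univ (a, b, c, d)))
    refine Finset.prod_eq_one fun v _ => ?_
    rw [if_neg, sub_zero]
    refine fun hsub => h ⟨v, ?_, ?_, ?_, ?_⟩ <;> exact hsub (by simp [T, S])
  · rw [expectation_sum]
    refine (Finset.sum_le_card_nsmul _ _ ((1 - p ^ 4) ^ (n - 4)) fun x _ => ?_).trans ?_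
    · rw [expectation_prod_one_sub]
      · have hcard v : (T x v).card = (S x).card := by simp [T]
        simp only [hcard, Finset.prod_const, Finset.card_compl, Fintype.card_fin]
        have h₁ := pow_le_one₀ (n := (S x).card) hp.1 hp.2
        have h₂ : p ^ 4 ≤ p ^ (S x).card := pow_le_pow_of_le_one hp.1 hp.2 (hS x)
        have h₃ : n - 4 ≤ n - (S x).card := Nat.sub_le_sub_left (hS x) n
        have h₄ : 0 ≤ p ^ 4 := pow_nonneg hp.1 4
        calc (1 - p ^ (S x).card) ^ (n - (S x).card)
            ≤ (1 - p ^ 4) ^ (n - (S x).card) :=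
              pow_le_pow_left₀ (by linarith) (by linarith) _
          _ ≤ (1 - p ^ 4) ^ (n - 4) :=
              pow_le_pow_of_le_one (by linarith) (by linarith) h₃
      · intro v hv e he
        obtain ⟨h₁, h₂⟩ := Finset.mem_product.1 he
        rw [Finset.mem_singleton] at h₂
        rw [Finset.mem_compl, ← h₂] at hv
        exact Finset.mem_offDiag.2 ⟨Finset.mem_univ _, Finset.mem_univ _, fun h => hv (h ▸ h₁)⟩
      · intro v _ w _ hvw
        refine Finset.disjoint_left.2 fun e he he' => hvw ?_
        have h₁ := Finset.mem_singleton.1 (Finset.mem_product.1 he).2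
        have h₂ := Finset.mem_singleton.1 (Finset.mem_product.1 he').2
        exact h₁.symm.trans h₂
    · refine le_of_eq ?_
      simp only [Finset.card_univ, Fintype.card_prod, Fintype.card_fin, nsmul_eq_mul]
      push_cast
      ring

theorem prob_flagBetti_one_ne_zero_le_sum {n : ℕ} {p : ℝ} (hp : p ∈ Set.Icc (0 : ℝ) 1) :
    prob n p {G | G.flagBetti ℤ 1 ≠ 0} ≤
      ∑ s ∈ Finset.Icc 1 n, (Real.exp 1 ^ 2 * (n * p)) ^ s := by
  let I (S : Finset (Fin n)) (T : Finset (Fin n × Fin n)) (G : SimpleDigraph (Fin n)) : ℝ :=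
    if T ⊆ G.edges then 1 else 0
  have hI S T G : 0 ≤ I S T G := by
    simp only [I]
    split_ifs <;> simp
  have hI' S G : 0 ≤ ∑ T ∈ (S.offDiag).powersetCard S.card, I S T G :=
    Finset.sum_nonneg fun T _ => hI S T G
  -- The empty set must be left out: it would contribute 1 to the bound.
  let P : Finset (Finset (Fin n)) := Finset.univ.powerset.filter (·.Nonempty)
  refine (prob_le_expectation hp (X := fun G => ∑ S ∈ P,
    ∑ T ∈ (S.offDiag).powersetCard S.card, I S T G)
    (fun G => Finset.sum_nonneg fun S _ => hI' S G) fun G hG => ?_).trans ?_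
  · obtain ⟨S, T, hS, hTS, hcard, hTG⟩ := G.exists_offDiag_subset_of_flagBetti_ne_zero hG
    calc (1 : ℝ) = I S T G := (if_pos hTG).symm
      _ ≤ _ := Finset.single_le_sum (f := fun T => I S T G) (fun T _ => hI S T G)
          (Finset.mem_powersetCard.2 ⟨hTS, hcard⟩)
      _ ≤ _ := Finset.single_le_sum
          (f := fun S => ∑ T ∈ (S.offDiag).powersetCard S.card, I S T G) (fun S _ => hI' S G)
          (by simpa [P] using hS)
  · rw [expectation_sum]
    have hS (S : Finset (Fin n)) : expectation n p (fun G =>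
        ∑ T ∈ (S.offDiag).powersetCard S.card, I S T G) =
        ((S.card * S.card - S.card).choose S.card : ℝ) * p ^ S.card := by
      rw [expectation_sum]
      have hT : ∀ T ∈ (S.offDiag).powersetCard S.card,
          expectation n p (I S T) = p ^ S.card := by
        intro T hT
        rw [Finset.mem_powersetCard] at hT
        rw [← hT.2]
        exact expectation_subset_edges p (hT.1.trans (Finset.offDiag_mono (Finset.subset_univ S)))
      rw [Finset.sum_congr rfl hT]
      simp [Finset.offDiag_card]
    simp only [hS, P]
    rw [Finset.sum_filter]
    have := Finset.sum_powerset_apply_card (x := (Finset.univ : Finset (Fin n)))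
      (fun s => if 0 < s then ((s * s - s).choose s : ℝ) * p ^ s else 0)
    simp only [Finset.card_pos] at this
    rw [this, Finset.card_univ, Fintype.card_fin]
    have hr : Finset.Icc 1 n = (Finset.range (n + 1)).filter (0 < ·) := by
      ext s
      simp
      lia
    rw [hr, Finset.sum_filter]
    refine Finset.sum_le_sum fun s _ => ?_
    split_ifs
    -- The two factorials in the denominators pair with `s ^ (2 * s)`, and each quotient `s ^ s /
    -- s!` is at most `e ^ s`; hence the `e ^ 2`.
    · have h₁ : (n.choose s : ℝ) ≤ (n : ℝ) ^ s / s.factorial := Nat.choose_le_pow_div s n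
      have h₂ : ((s * s - s).choose s : ℝ) ≤ ((s : ℝ) ^ 2) ^ s / s.factorial := by
        refine (Nat.choose_le_pow_div s (s * s - s)).trans ?_
        gcongr
        rw [sq]
        exact_mod_cast Nat.sub_le _ _
      have h₃ : (s : ℝ) ^ s / s.factorial ≤ Real.exp 1 ^ s := by
        rw [← Real.exp_nat_mul, mul_one]
        exact Real.pow_div_factorial_le_exp s (Nat.cast_nonneg s) s
      have h₄ := pow_nonneg hp.1 s
      rw [nsmul_eq_mul]
      calc (n.choose s : ℝ) * (((s * s - s).choose s : ℝ) * p ^ s)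
          ≤ (n : ℝ) ^ s / s.factorial * (((s : ℝ) ^ 2) ^ s / s.factorial * p ^ s) := by gcongr
        _ = ((s : ℝ) ^ s / s.factorial) ^ 2 * ((n : ℝ) * p) ^ s := by
          rw [mul_pow, ← pow_mul]
          ring
        _ ≤ (Real.exp 1 ^ s) ^ 2 * ((n : ℝ) * p) ^ s := by
          have := hp.1
          gcongr
        _ = (Real.exp 1 ^ 2 * (n * p)) ^ s := by ring
    · simp

end RandomDigraph

namespace RandomDigraph

/-! ### Limits -/

theorem tendsto_mul_pow_zero {p : ℕ → ℝ} (j : ℕ) (hj : j ≠ 0)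
    (h : p =o[atTop] fun n : ℕ => (n : ℝ) ^ (-1 / (j : ℝ))) :
    Tendsto (fun n : ℕ => (n : ℝ) * p n ^ j) atTop (𝓝 0) := by
  refine (h.pow (Nat.pos_of_ne_zero hj)).tendsto_div_nhds_zero.congr fun n => ?_
  have hj' : (j : ℝ) ≠ 0 := Nat.cast_ne_zero.2 hj
  rw [← Real.rpow_mul_natCast (Nat.cast_nonneg n), div_mul_cancel₀ _ hj', Real.rpow_neg_one,
    div_inv_eq_mul, mul_comm]

theorem tendsto_mul_pow_atTop {p : ℕ → ℝ} (hp : ∀ n, 0 ≤ p n) (j : ℕ) (hj : j ≠ 0)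
    (h : (fun n : ℕ => (n : ℝ) ^ (-1 / (j : ℝ))) =o[atTop] p) :
    Tendsto (fun n : ℕ => (n : ℝ) * p n ^ j) atTop atTop := by
  have hj' : (j : ℝ) ≠ 0 := Nat.cast_ne_zero.2 hj
  rw [tendsto_atTop]
  intro C
  -- With this constant, `n⁻¹ ≤ c * p ^ j` becomes `|C| + 1 ≤ n * p ^ j`.
  have h₁ := (h.pow (Nat.pos_of_ne_zero hj)).bound (c := (|C| + 1)⁻¹) (by positivity)
  filter_upwards [h₁, eventually_gt_atTop 0] with n hn hn0
  rw [← Real.rpow_mul_natCast (Nat.cast_nonneg n), div_mul_cancel₀ _ hj', Real.rpow_neg_one,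
    Real.norm_of_nonneg (by positivity), Real.norm_of_nonneg (pow_nonneg (hp n) j),
    inv_mul_eq_div, le_div_iff₀ (by positivity), inv_mul_le_iff₀ (by positivity)] at hn
  linarith [le_abs_self C]

theorem tendsto_prob_of_compl {p : ℕ → ℝ} {A : (n : ℕ) → Set (SimpleDigraph (Fin n))}
    (h : Tendsto (fun n => prob n (p n) (A n)ᶜ) atTop (𝓝 0)) :
    Tendsto (fun n => prob n (p n) (A n)) atTop (𝓝 1) := by
  have := h.const_sub 1
  rw [sub_zero] at this
  exact this.congr fun n => by rw [← prob_add_prob_compl n (p n) (A n), add_sub_cancel_right]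

/-- An `m`-tuple of distinct vertices can be extended by `n - m` last vertices, each requiring `m`
new edges. -/
theorem expectation_cliqueCount_succ (n m : ℕ) (p : ℝ) :
    expectation n p (fun G => (G.cliqueCount (m + 1) : ℝ)) =
      expectation n p (fun G => (G.cliqueCount m : ℝ)) * (((n - m : ℕ) : ℝ) * p ^ m) := by
  rw [expectation_cliqueCount, expectation_cliqueCount, Nat.descFactorial_succ,
    Nat.choose_succ_succ' m 1, Nat.choose_one_right, pow_add]
  push_cast
  ring

theorem tendsto_expectation_flagBetti_div_expectation_cliqueCount {p : ℕ → ℝ}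
    (hp : ∀ᶠ n in atTop, p n ∈ Set.Icc (0 : ℝ) 1) (k : ℕ)
    (h₁ : Tendsto (fun n : ℕ => (n : ℝ) * p n ^ k) atTop atTop)
    (h₂ : Tendsto (fun n : ℕ => (n : ℝ) * p n ^ (k + 1)) atTop (𝓝 0)) :
    Tendsto (fun n : ℕ => expectation n (p n) (fun G => (G.flagBetti ℤ k : ℝ)) /
      expectation n (p n) (fun G => (G.cliqueCount (k + 1) : ℝ))) atTop (𝓝 1) := by
  have hlower : Tendsto (fun n : ℕ => 1 - 2 * ((n : ℝ) * p n ^ k)⁻¹ - (n : ℝ) * p n ^ (k + 1))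
      atTop (𝓝 1) := by
    simpa using ((h₁.inv_tendsto_atTop.const_mul 2).const_sub 1).sub h₂
  -- The bound `2 * k + 1 ≤ n` gives `n - k ≥ n / 2`, the source of the factor 2 in `hlower`.
  have hev : ∀ᶠ n : ℕ in atTop, p n ∈ Set.Icc (0 : ℝ) 1 ∧ 0 < (n : ℝ) * p n ^ k ∧ 2 * k + 1 ≤ n :=
    hp.and ((h₁.eventually_gt_atTop 0).and (eventually_ge_atTop _))
  have hpos : ∀ᶠ n : ℕ in atTop, 0 < expectation n (p n) (fun G => (G.cliqueCount k : ℝ)) := by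
    filter_upwards [hev] with n ⟨hpn, hnp, hkn⟩
    rw [expectation_cliqueCount]
    have h : 0 < n.descFactorial k := Nat.descFactorial_pos.2 (by lia)
    have h' : 0 < p n ^ k.choose 2 := by
      -- For `k = 0` the exponent is 0, so `p n` may vanish; otherwise `n * p n ^ k > 0` forces `p n
      -- > 0`.
      rcases Nat.eq_zero_or_pos k with rfl | hk
      · simp
      · refine pow_pos (hpn.1.lt_of_ne fun h0 => ?_) _
        simp [← h0, hk.ne'] at hnp
    positivity
  refine tendsto_of_tendsto_of_tendsto_of_le_of_le' hlower tendsto_const_nhds ?_ ?_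
  · filter_upwards [hev, hpos] with n ⟨hpn, hnp, hkn⟩ hFk
    have hle := expectation_mono (n := n) hpn
      (X := fun G => (G.cliqueCount (k + 1) : ℝ))
      (Y := fun G => ((G.flagBetti ℤ k : ℝ) + G.cliqueCount k) + G.cliqueCount (k + 2))
      (fun G => by exact_mod_cast G.cliqueCount_le_flagBetti_add k)
    rw [expectation_add, expectation_add] at hle
    have hF₁ := expectation_cliqueCount_succ n k (p n)
    have hF₂ := expectation_cliqueCount_succ n (k + 1) (p n)
    set F₀ := expectation n (p n) (fun G => (G.cliqueCount k : ℝ))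
    set F₁ := expectation n (p n) (fun G => (G.cliqueCount (k + 1) : ℝ))
    have hhalf : (n : ℝ) * p n ^ k / 2 ≤ ((n - k : ℕ) : ℝ) * p n ^ k := by
      have hcast : (2 * k + 1 : ℝ) ≤ n := by exact_mod_cast hkn
      rw [Nat.cast_sub (by lia), mul_div_right_comm]
      have := pow_nonneg hpn.1 k
      gcongr
      linarith
    have hF₁pos : 0 < F₁ := by
      rw [hF₁]
      exact mul_pos hFk (by linarith)
    have h₃ : F₀ ≤ F₁ * (2 * ((n : ℝ) * p n ^ k)⁻¹) := by
      rw [← div_eq_mul_inv, ← mul_div_assoc, le_div_iff₀ hnp, hF₁]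
      nlinarith
    have h₄ : expectation n (p n) (fun G => (G.cliqueCount (k + 2) : ℝ)) ≤
        F₁ * ((n : ℝ) * p n ^ (k + 1)) := by
      rw [hF₂]
      have := pow_nonneg hpn.1 (k + 1)
      gcongr
      lia
    rw [le_div_iff₀ hF₁pos]
    linarith
  · filter_upwards [hev] with n ⟨hpn, _, _⟩
    refine div_le_one_of_le₀ (expectation_mono hpn fun G => ?_) ?_
    · exact_mod_cast G.flagBetti_le_cliqueCount k
    · rw [← expectation_const n (p n) 0]
      exact expectation_mono hpn fun G => Nat.cast_nonneg _

theorem tendsto_prob_flagBetti_one_pos {p : ℕ → ℝ}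
    (hp : ∀ᶠ n in atTop, p n ∈ Set.Icc (0 : ℝ) 1)
    (h₁ : Tendsto (fun n : ℕ => (n : ℝ) * p n) atTop atTop)
    (h₂ : Tendsto (fun n : ℕ => (n : ℝ) * p n ^ 2) atTop (𝓝 0)) :
    Tendsto (fun n : ℕ => prob n (p n) {G | 0 < G.flagBetti ℤ 1}) atTop (𝓝 1) := by
  have hupper : Tendsto (fun n : ℕ => 4 * ((n : ℝ) * p n)⁻¹ + 4 * ((n : ℝ) * p n ^ 2))
      atTop (𝓝 0) := by
    simpa using (h₁.inv_tendsto_atTop.const_mul 4).add (h₂.const_mul 4)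
  refine tendsto_prob_of_compl (tendsto_of_tendsto_of_tendsto_of_le_of_le' tendsto_const_nhds
    hupper (hp.mono fun n hpn => prob_nonneg hpn _) ?_)
  -- Since `n - 1 ≥ n / 2`, the bound `n * p ≥ 8` makes the mean `M` of the number of edges at least
  -- `4 * n`.
  filter_upwards [hp, h₁.eventually_ge_atTop 8, eventually_ge_atTop 2] with n hpn hnp hn
  set M : ℝ := (n * (n - 1) : ℕ) * p n with hM
  have hn' : (2 : ℝ) ≤ n := by exact_mod_cast hn
  have hM' : M = ((n : ℝ) - 1) * (n * p n) := by
    rw [hM, Nat.cast_mul, Nat.cast_sub (by lia), Nat.cast_one]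
    ring
  have hM₁ : n * p n ≤ M := by
    rw [hM']
    nlinarith
  have hM₂ : 4 * n ≤ M := by
    rw [hM']
    nlinarith
  have hM₀ : 0 < M := by linarith
  -- If `β_1 = 0`, the number of edges is at most `n + c_3`. Either `c_3 ≥ M / 4` and the Markov
  -- term is at least 1, or there are at most `M / 2` edges and the Chebyshev term is.
  refine (prob_le_expectation hpn (X := fun G => 4 / M ^ 2 * ((G.edges.card : ℝ) - M) ^ 2 +
    4 / M * (G.cliqueCount 3 : ℝ)) (fun G => by positivity) fun G hG => ?_).trans ?_
  · have hb : G.flagBetti ℤ 1 = 0 := by simpa using hG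
    have hle := G.cliqueCount_le_flagBetti_add 1
    have hedges : (G.edges.card : ℝ) ≤ n + G.cliqueCount 3 := by
      have := G.card_edges_le_cliqueCount_two
      have := G.cliqueCount_one_le
      norm_cast
      simp only [Nat.reduceAdd] at hle
      lia
    rcases le_total (M / 4) (G.cliqueCount 3 : ℝ) with h | h
    · have h₃ : 1 ≤ 4 / M * (G.cliqueCount 3 : ℝ) := by
        rw [div_mul_eq_mul_div, le_div_iff₀ hM₀]
        linarith
      have h₄ : 0 ≤ 4 / M ^ 2 * ((G.edges.card : ℝ) - M) ^ 2 := by positivity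
      linarith
    · have h₃ : 1 ≤ 4 / M ^ 2 * ((G.edges.card : ℝ) - M) ^ 2 := by
        rw [div_mul_eq_mul_div, le_div_iff₀ (by positivity)]
        nlinarith
      have h₄ : 0 ≤ 4 / M * (G.cliqueCount 3 : ℝ) := by positivity
      linarith
  · have hvar := expectation_card_edges_sub_sq n (p n)
    rw [← hM] at hvar
    rw [expectation_add, expectation_const_mul, expectation_const_mul, hvar,
      expectation_cliqueCount]
    have hp0 := hpn.1
    gcongr ?_ + ?_
    · calc 4 / M ^ 2 * (((n * (n - 1) : ℕ) : ℝ) * (p n * (1 - p n)))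
          = 4 / M ^ 2 * (M * (1 - p n)) := by rw [hM]; ring
        _ ≤ 4 / M ^ 2 * (M * 1) := by
          gcongr
          linarith
        _ = 4 * M⁻¹ := by field_simp
        _ ≤ 4 * ((n : ℝ) * p n)⁻¹ := by
          have : 0 < (n : ℝ) * p n := by linarith
          gcongr
    · have hdesc : (n.descFactorial 3 : ℝ) * p n ^ Nat.choose 3 2 =
          M * (((n - 2 : ℕ) : ℝ) * p n ^ 2) := by
        rw [hM, show Nat.choose 3 2 = 3 from rfl]
        simp only [Nat.descFactorial_succ, Nat.descFactorial_zero]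
        push_cast
        simp only [Nat.sub_zero]
        ring
      rw [hdesc, ← mul_assoc, div_mul_cancel₀ _ hM₀.ne']
      gcongr
      lia

theorem tendsto_prob_flagBetti_one_eq_zero_of_sparse {p : ℕ → ℝ}
    (hp : ∀ᶠ n in atTop, p n ∈ Set.Icc (0 : ℝ) 1)
    (h : Tendsto (fun n : ℕ => (n : ℝ) * p n) atTop (𝓝 0)) :
    Tendsto (fun n : ℕ => prob n (p n) {G | G.flagBetti ℤ 1 = 0}) atTop (𝓝 1) := by
  have h₁ : Tendsto (fun n : ℕ => Real.exp 1 ^ 2 * ((n : ℝ) * p n)) atTop (𝓝 0) := by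
    have := h.const_mul (Real.exp 1 ^ 2)
    rwa [mul_zero] at this
  have h₂ : Tendsto (fun n : ℕ => 2 * (Real.exp 1 ^ 2 * ((n : ℝ) * p n))) atTop (𝓝 0) := by
    have := h₁.const_mul 2
    rwa [mul_zero] at this
  refine tendsto_prob_of_compl (tendsto_of_tendsto_of_tendsto_of_le_of_le' tendsto_const_nhds
    h₂ (hp.mono fun n hpn => prob_nonneg hpn _) ?_)
  filter_upwards [hp, h₁.eventually_le_const (show (0 : ℝ) < 1 / 2 by norm_num)] with n hpn hx
  refine (prob_flagBetti_one_ne_zero_le_sum hpn).trans ?_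
  have hx₀ : 0 ≤ Real.exp 1 ^ 2 * ((n : ℝ) * p n) := by
    have := hpn.1
    positivity
  set x := Real.exp 1 ^ 2 * ((n : ℝ) * p n)
  -- As `x ≤ 1 / 2`, this identity bounds the sum by `2 * x`.
  have hgeom (m : ℕ) : (1 - x) * ∑ s ∈ Finset.Icc 1 m, x ^ s = x - x ^ (m + 1) := by
    induction m with
    | zero => simp
    | succ m ih =>
      rw [Finset.sum_Icc_succ_top (by lia), mul_add, ih]
      ring
  have hsum : 0 ≤ ∑ s ∈ Finset.Icc 1 n, x ^ s := Finset.sum_nonneg fun s _ => pow_nonneg hx₀ s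
  nlinarith [hgeom n, pow_nonneg hx₀ (n + 1)]

theorem tendsto_prob_flagBetti_one_eq_zero_of_dense {p : ℕ → ℝ}
    (hp : ∀ᶠ n in atTop, p n ∈ Set.Icc (0 : ℝ) 1)
    (h : ∀ᶠ n : ℕ in atTop, 16 * Real.log n ≤ (n : ℝ) * p n ^ 4) :
    Tendsto (fun n : ℕ => prob n (p n) {G | G.flagBetti ℤ 1 = 0}) atTop (𝓝 1) := by
  refine tendsto_prob_of_compl (tendsto_of_tendsto_of_tendsto_of_le_of_le' tendsto_const_nhds
    tendsto_inv_atTop_nhds_zero_nat (hp.mono fun n hpn => prob_nonneg hpn _) ?_)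
  filter_upwards [hp, h, eventually_ge_atTop 8] with n hpn hlog hn
  have hn' : (8 : ℝ) ≤ n := by exact_mod_cast hn
  have hp4 : 0 ≤ p n ^ 4 := pow_nonneg hpn.1 4
  have hp4' : p n ^ 4 ≤ 1 := pow_le_one₀ hpn.1 hpn.2
  have hmono : prob n (p n) {G | G.flagBetti ℤ 1 = 0}ᶜ ≤
      prob n (p n) {G | ¬∀ a b c d : Fin n, ∃ v, (a, v) ∈ G.edges ∧ (b, v) ∈ G.edges ∧
        (c, v) ∈ G.edges ∧ (d, v) ∈ G.edges} :=
    expectation_mono hpn fun G => Set.indicator_le_indicator_of_subset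
      (Set.compl_subset_comm.1 fun G hG => G.flagBetti_one_eq_zero (not_not.1 hG))
      (fun _ => zero_le_one) G
  refine hmono.trans ((prob_not_commonOutNeighbour_le hpn).trans ?_)
  have hlog0 : 0 ≤ Real.log n := Real.log_nonneg (by linarith)
  -- For `n ≥ 8`, `n - 4 ≥ n / 2`, so `(n - 4) * p ^ 4 ≥ 8 * log n`, which outweighs the `4 * log n`
  -- coming from the quadruples.
  calc (n : ℝ) ^ 4 * (1 - p n ^ 4) ^ (n - 4)
      ≤ (n : ℝ) ^ 4 * Real.exp (-p n ^ 4) ^ (n - 4) := by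
        gcongr
        exact Real.one_sub_le_exp_neg _
    _ = Real.exp (4 * Real.log n + ((n : ℝ) - 4) * -p n ^ 4) := by
        rw [← Real.exp_nat_mul, Nat.cast_sub (by lia), Real.exp_add, mul_comm 4,
          ← Real.rpow_def_of_pos (by linarith)]
        norm_cast
    _ ≤ Real.exp (-Real.log n) := by
        refine Real.exp_le_exp.2 ?_
        nlinarith
    _ = (n : ℝ)⁻¹ := by rw [Real.exp_neg, Real.exp_log (by linarith)]

/-! ### Growth conditions for powers of `n` and at the dense threshold -/

theorem tendsto_mul_rpow_pow_atTop {α : ℝ} {j : ℕ} (h : 0 < 1 + α * j) :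
    Tendsto (fun n : ℕ => (n : ℝ) * ((n : ℝ) ^ α) ^ j) atTop atTop := by
  refine ((tendsto_rpow_atTop h).comp tendsto_natCast_atTop_atTop).congr' ?_
  filter_upwards [eventually_gt_atTop 0] with n hn
  rw [Function.comp_apply, Real.rpow_add (by positivity), Real.rpow_one,
    Real.rpow_mul_natCast (by positivity)]

theorem tendsto_mul_rpow_pow_zero {α : ℝ} {j : ℕ} (h : 1 + α * j < 0) :
    Tendsto (fun n : ℕ => (n : ℝ) * ((n : ℝ) ^ α) ^ j) atTop (𝓝 0) := by
  refine ((tendsto_rpow_neg_atTop (neg_pos.2 h)).comp tendsto_natCast_atTop_atTop).congr' ?_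
  filter_upwards [eventually_gt_atTop 0] with n hn
  rw [Function.comp_apply, neg_neg, Real.rpow_add (by positivity), Real.rpow_one,
    Real.rpow_mul_natCast (by positivity)]

theorem eventually_rpow_mem_Icc {α : ℝ} (h : α ≤ 0) :
    ∀ᶠ n : ℕ in atTop, (n : ℝ) ^ α ∈ Set.Icc (0 : ℝ) 1 := by
  filter_upwards [eventually_ge_atTop 1] with n hn
  exact ⟨by positivity, Real.rpow_le_one_of_one_le_of_nonpos (by exact_mod_cast hn) h⟩

theorem eventually_log_le_mul_rpow_pow_four {α : ℝ} (h : -1 / 4 < α) :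
    ∀ᶠ n : ℕ in atTop, 16 * Real.log n ≤ (n : ℝ) * ((n : ℝ) ^ α) ^ 4 := by
  have hr : 0 < 1 + α * (4 : ℕ) := by
    push_cast
    linarith
  have := tendsto_natCast_atTop_atTop.eventually
    ((isLittleO_log_rpow_atTop hr).bound (c := 1 / 16) (by norm_num))
  filter_upwards [this, eventually_ge_atTop 1] with n hn hn1
  rw [Real.norm_of_nonneg (Real.log_nonneg (by exact_mod_cast hn1)),
    Real.norm_of_nonneg (by positivity), Real.rpow_add (by positivity), Real.rpow_one,
    Real.rpow_mul_natCast (by positivity)] at hn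
  linarith

theorem eventually_log_le_mul_pow_four {p : ℕ → ℝ} (hp : ∀ n, 0 ≤ p n)
    (h : (fun n : ℕ => ((n : ℝ) / Real.log n) ^ (-1 / 4 : ℝ)) =o[atTop] p) :
    ∀ᶠ n : ℕ in atTop, 16 * Real.log n ≤ (n : ℝ) * p n ^ 4 := by
  filter_upwards [(h.pow (n := 4) (by norm_num)).bound (c := 1 / 16) (by norm_num),
    eventually_ge_atTop 2] with n hn hn2
  have hn' : (2 : ℝ) ≤ n := by exact_mod_cast hn2
  have hlog : 0 < Real.log n := Real.log_pos (by linarith)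
  rw [← Real.rpow_mul_natCast (by positivity), show (-1 / 4 : ℝ) * (4 : ℕ) = -1 by norm_num,
    Real.rpow_neg_one, inv_div, Real.norm_of_nonneg (by positivity),
    Real.norm_of_nonneg (pow_nonneg (hp n) 4), div_le_iff₀ (by positivity)] at hn
  linarith

end RandomDigraph

end

/-! ### The phase transitions -/

theorem mainTheorem5 :
    -- the four statements for `p(n) = n ^ α`
    (∀ α : ℝ,
      (-1 < α → α < -1 / 2 →
        Tendsto (fun n : ℕ =>
            RandomDigraph.expectation n ((n : ℝ) ^ α) (fun G => (G.flagBetti ℤ 1 : ℝ)) /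
              ((n : ℝ) * ((n : ℝ) - 1) * (n : ℝ) ^ α))
          atTop (𝓝 1)) ∧
      (-1 < α → α < -1 / 2 →
        Tendsto (fun n : ℕ => RandomDigraph.prob n ((n : ℝ) ^ α) {G | 0 < G.flagBetti ℤ 1})
          atTop (𝓝 1)) ∧
      (α < -1 →
        Tendsto (fun n : ℕ => RandomDigraph.prob n ((n : ℝ) ^ α) {G | G.flagBetti ℤ 1 = 0})
          atTop (𝓝 1)) ∧
      (-1 / 4 < α → α ≤ 0 →
        Tendsto (fun n : ℕ => RandomDigraph.prob n ((n : ℝ) ^ α) {G | G.flagBetti ℤ 1 = 0})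
          atTop (𝓝 1))) ∧
    -- the statements for a general edge probability `p = p(n)`
    (∀ p : ℕ → ℝ, (∀ n, p n ∈ Set.Icc (0 : ℝ) 1) →
      (∀ k : ℕ,
        (1 ≤ k → (fun n : ℕ => (n : ℝ) ^ (-1 / (k : ℝ))) =o[atTop] p) →
        (p =o[atTop] fun n : ℕ => (n : ℝ) ^ (-1 / ((k : ℝ) + 1))) →
        Tendsto (fun n : ℕ =>
            RandomDigraph.expectation n (p n) (fun G => (G.flagBetti ℤ k : ℝ)) /
              ((n.choose (k + 1) : ℝ) * ((k + 1).factorial : ℝ) * p n ^ ((k + 1).choose 2)))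
          atTop (𝓝 1)) ∧
      (((fun n : ℕ => (n : ℝ) ^ (-1 : ℝ)) =o[atTop] p) →
        (p =o[atTop] fun n : ℕ => (n : ℝ) ^ (-1 / 2 : ℝ)) →
        Tendsto (fun n : ℕ => RandomDigraph.prob n (p n) {G | 0 < G.flagBetti ℤ 1})
          atTop (𝓝 1)) ∧
      ((p =o[atTop] fun n : ℕ => (n : ℝ) ^ (-1 : ℝ)) →
        Tendsto (fun n : ℕ => RandomDigraph.prob n (p n) {G | G.flagBetti ℤ 1 = 0})
          atTop (𝓝 1)) ∧
      (((fun n : ℕ => ((n : ℝ) / Real.log n) ^ (-1 / 4 : ℝ)) =o[atTop] p) →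
        Tendsto (fun n : ℕ => RandomDigraph.prob n (p n) {G | G.flagBetti ℤ 1 = 0})
          atTop (𝓝 1))) := by
  -- The denominator is exactly `E c_{k+1}`.
  have hdiv (p : ℕ → ℝ) (k : ℕ) (h : Tendsto (fun n : ℕ =>
      RandomDigraph.expectation n (p n) (fun G => (G.flagBetti ℤ k : ℝ)) /
        RandomDigraph.expectation n (p n) (fun G => (G.cliqueCount (k + 1) : ℝ))) atTop (𝓝 1)) :
      Tendsto (fun n : ℕ =>
        RandomDigraph.expectation n (p n) (fun G => (G.flagBetti ℤ k : ℝ)) /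
          ((n.choose (k + 1) : ℝ) * ((k + 1).factorial : ℝ) * p n ^ ((k + 1).choose 2)))
        atTop (𝓝 1) := by
    refine h.congr fun n => ?_
    rw [RandomDigraph.expectation_cliqueCount, Nat.descFactorial_eq_factorial_mul_choose,
      Nat.cast_mul, mul_comm ((k + 1).factorial : ℝ)]
  refine ⟨fun α => ⟨fun h₁ h₂ => ?_, fun h₁ h₂ => ?_, fun h => ?_, fun h₁ h₂ => ?_⟩,
    fun p hp => ⟨fun k h₁ h₂ => ?_, fun h₁ h₂ => ?_, fun h => ?_, fun h => ?_⟩⟩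
  · refine (hdiv _ 1
      (RandomDigraph.tendsto_expectation_flagBetti_div_expectation_cliqueCount
        (RandomDigraph.eventually_rpow_mem_Icc (by linarith)) 1
        (RandomDigraph.tendsto_mul_rpow_pow_atTop (by push_cast; linarith))
        (RandomDigraph.tendsto_mul_rpow_pow_zero (by push_cast; linarith)))).congr fun n => ?_
    rw [show Nat.choose (1 + 1) 2 = 1 from rfl, show Nat.factorial (1 + 1) = 2 from rfl,
      Nat.cast_choose_two, pow_one, Nat.cast_two, div_mul_cancel₀ _ two_ne_zero]
  · refine RandomDigraph.tendsto_prob_flagBetti_one_pos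
      (RandomDigraph.eventually_rpow_mem_Icc (by linarith)) ?_
      (RandomDigraph.tendsto_mul_rpow_pow_zero (by push_cast; linarith))
    simpa only [pow_one] using
      RandomDigraph.tendsto_mul_rpow_pow_atTop (α := α) (j := 1) (by push_cast; linarith)
  · refine RandomDigraph.tendsto_prob_flagBetti_one_eq_zero_of_sparse
      (RandomDigraph.eventually_rpow_mem_Icc (by linarith)) ?_
    simpa only [pow_one] using
      RandomDigraph.tendsto_mul_rpow_pow_zero (α := α) (j := 1) (by push_cast; linarith)
  · exact RandomDigraph.tendsto_prob_flagBetti_one_eq_zero_of_dense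
      (RandomDigraph.eventually_rpow_mem_Icc h₂)
      (RandomDigraph.eventually_log_le_mul_rpow_pow_four h₁)
  · refine hdiv p k (RandomDigraph.tendsto_expectation_flagBetti_div_expectation_cliqueCount
      (.of_forall hp) k ?_ (RandomDigraph.tendsto_mul_pow_zero (k + 1) k.succ_ne_zero ?_))
    -- For `k = 0` nothing is assumed, and `n * p n ^ 0 = n` diverges anyway.
    · rcases Nat.eq_zero_or_pos k with rfl | hk
      · simpa using tendsto_natCast_atTop_atTop (R := ℝ)
      · exact RandomDigraph.tendsto_mul_pow_atTop (fun n => (hp n).1) k hk.ne' (h₁ hk)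
    · exact_mod_cast h₂
  · refine RandomDigraph.tendsto_prob_flagBetti_one_pos (.of_forall hp) ?_
      (RandomDigraph.tendsto_mul_pow_zero 2 two_ne_zero (by exact_mod_cast h₂))
    simpa only [pow_one] using RandomDigraph.tendsto_mul_pow_atTop (fun n => (hp n).1) 1
      one_ne_zero (by simpa using h₁)
  · refine RandomDigraph.tendsto_prob_flagBetti_one_eq_zero_of_sparse (.of_forall hp) ?_
    simpa only [pow_one] using RandomDigraph.tendsto_mul_pow_zero 1 one_ne_zero (by simpa using h)
  · exact RandomDigraph.tendsto_prob_flagBetti_one_eq_zero_of_dense (.of_forall hp)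
      (RandomDigraph.eventually_log_le_mul_pow_four (fun n => (hp n).1) h)
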